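/- For a complex polynomial $f(z)=a\prod_{n=1}^N(z-\alpha_n)$ with $a\neq 0$, let $M(f)=\log|a|+\sum_{n=1}^N\log^+|\alpha_n|$ be its (logarithmic) Mahler measure, and for $\gamma\in\overline{\mathbb Q}^\times$ let $M(\gamma)$ be the Mahler measure of the minimal polynomial of $\gamma$ over $\mathbb Z$. For a sequence ${\bf x}=(x_1,x_2,\ldots)$ of real numbers with all but finitely many entries equal to $0$, put $\|{\bf x}\|_t=\left(\sum_{n\ge 1}|x_n|^t\right)^{1/t}$ for $0<t<\infty$ and $\|{\bf x}\|_\infty=\max_{n\ge 1}|x_n|$. For $\alpha\in\overline{\mathbb Q}^\times$ and $t\in(0,\infty]$ define $$M_t(\alpha)=\inf\Big\{\|(M(\alpha_1),M(\alpha_2),\ldots)\|_t:\ \alpha_n\in\overline{\mathbb Q}^\times,\ \alpha_n=1\text{ for all but finitely many }n,\ \prod_{n\ge 1}\alpha_n=\alpha\Big\}.$$ A set $I\subseteq(0,\infty]$ is called $\alpha$-uniform if there is a real sequence ${\bf x}$ with finitely many non-zero entries such that $M_t(\alpha)=\|{\bf x}\|_t$ for all $t\in I$. A point $s\in(0,\infty]$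 is called $\alpha$-standard if it has an $\alpha$-uniform open neighbourhood in $(0,\infty]$, and $\alpha$-exceptional otherwise. Theorem. If $\alpha$ is a non-zero algebraic number and $T$ is a positive real number, then there are only finitely many $\alpha$-exceptional points in $(0,T)$. -/

import Mathlib

open scoped ENNReal Polynomial nonZeroDivisors

noncomputable section

namespace MetricMahler

/-- The field of algebraic numbers, realised as the algebraic closure of `ℚ` inside `ℂ`. -/
abbrev QBar : IntermediateField ℚ ℂ := algebraicClosure ℚ ℂ

/-- The minimal polynomial over `ℤ` of an algebraic number: the primitive integer polynomial
obtained by clearing denominators in the minimal polynomial over `ℚ`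
(determined up to sign, which does not affect the Mahler measure). -/
def intMinpoly (α : ℂ) : ℤ[X] :=
  (IsLocalization.integerNormalization ℤ⁰ (minpoly ℚ α)).primPart

/-- The logarithmic Mahler measure of a non-zero algebraic number. -/
def M (α : QBarˣ) : ℝ :=
  ((intMinpoly ((α : QBar) : ℂ)).map (Int.castRingHom ℂ)).logMahlerMeasure

/-- Sequences in `G` all but finitely many of whose terms are the identity. -/
def FinSeq (G : Type*) [CommGroup G] : Type _ :=
  {a : ℕ → G // (Function.mulSupport a).Finite}

/-- The product of all terms of a sequence that is eventually the identity. -/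
def tau {G : Type*} [CommGroup G] (a : FinSeq G) : G := ∏ᶠ n, a.1 n

/-- The `t`-norm of a finitely supported real sequence, for `0 < t ≤ ∞`. -/
def tNorm (t : ℝ≥0∞) (x : ℕ → ℝ) : ℝ :=
  if t = ∞ then ⨆ n, |x n| else (∑ᶠ n, |x n| ^ t.toReal) ^ (1 / t.toReal)

/-- The `t`-metric version `φ_t` of a height `φ` on `G`, for `0 < t ≤ ∞`. -/
def metricVersion {G : Type*} [CommGroup G] (φ : G → ℝ) (t : ℝ≥0∞) (g : G) : ℝ :=
  sInf {r : ℝ | ∃ a : FinSeq G, tau a = g ∧ r = tNorm t (fun n => φ (a.1 n))}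

/-- A set `I ⊆ (0, ∞]` is `α`-uniform if a single finitely supported real sequence `x`
satisfies `M_t(α) = ‖x‖_t` for all `t ∈ I`. -/
def IsUniform (α : QBarˣ) (I : Set ℝ≥0∞) : Prop :=
  I ⊆ Set.Ioi 0 ∧ ∃ x : ℕ →₀ ℝ, ∀ t ∈ I, metricVersion M t α = tNorm t x

/-- A point `s ∈ (0, ∞]` is `α`-standard if it has an `α`-uniform open neighbourhood. -/
def IsStandard (α : QBarˣ) (s : ℝ≥0∞) : Prop :=
  ∃ U : Set ℝ≥0∞, IsOpen U ∧ s ∈ U ∧ IsUniform α U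

/-- A point `s ∈ (0, ∞]` is `α`-exceptional if it is not `α`-standard. -/
def IsExceptional (α : QBarˣ) (s : ℝ≥0∞) : Prop :=
  0 < s ∧ ¬ IsStandard α s

end MetricMahler

end

/-! Let `K` be a finite normal extension of ℚ containing α, of degree d. Given a factorization of α,
take a finite Galois field E containing K and all factors, and let H be the normal subgroup of
Gal(E/ℚ) fixing K. Each factor γ is replaced by a radical of its norm, β with β^|H| = N_{E/K}(γ).
The β's multiply to α up to a root of unity, which joins as one more factor of measure 0, and M(β) ≤
M(γ) (`exists_radical_of_norm`, `exists_radical_factorization`).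

The degree of β is not bounded, but M(β) is the measure of an integer polynomial of degree at most d
(`exists_logM_eq_of_pow_mem`). Both facts come from multiplying conjugates over H-orbits
(`exists_block_polynomial`). By Northcott, only a finite set of values up to M(α) occurs.

For t < T, the trivial factorization beats every competitor with a larger power sum, so entries may
be taken at most M(α) and the number of non-zero ones is bounded. Only finitely many power-sum
functions of t remain. They are analytic, so distinct ones agree at finitely many points of [0, T];
elsewhere a minimizer at s stays minimal near s, and s is standard. -/

namespace MetricMahler

/-! ### Mahler measures of integer polynomials -/

open Polynomial Real

/-- The logarithmic Mahler measure of an integer polynomial. -/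
noncomputable def logM (p : ℤ[X]) : ℝ := (p.map (Int.castRingHom ℂ)).logMahlerMeasure

lemma map_intCast_complex_ne_zero {p : ℤ[X]} (hp : p ≠ 0) : p.map (Int.castRingHom ℂ) ≠ 0 :=
  (Polynomial.map_ne_zero_iff (Int.castRingHom ℂ).injective_int).2 hp

lemma logM_nonneg (p : ℤ[X]) : 0 ≤ logM p := by
  rcases eq_or_ne p 0 with rfl | hp
  · simp [logM]
  · rw [logM, logMahlerMeasure_eq_log_MahlerMeasure]
    exact log_nonneg (one_le_mahlerMeasure_of_ne_zero hp)

lemma logM_mul {p q : ℤ[X]} (hp : p ≠ 0) (hq : q ≠ 0) : logM (p * q) = logM p + logM q := by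
  rw [logM, Polynomial.map_mul, logMahlerMeasure_mul_eq_add_logMahlerMeasure]
  · rfl
  · exact mul_ne_zero (map_intCast_complex_ne_zero hp) (map_intCast_complex_ne_zero hq)

lemma logM_le_of_dvd {p q : ℤ[X]} (hq : q ≠ 0) (h : p ∣ q) : logM p ≤ logM q := by
  obtain ⟨r, rfl⟩ := h
  rw [logM_mul (left_ne_zero_of_mul hq) (right_ne_zero_of_mul hq)]
  linarith [logM_nonneg r]

/-- Northcott's theorem, phrased for the values of the logarithmic Mahler measure. -/
lemma finite_logM_values (d : ℕ) (B : ℝ) :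
    {x : ℝ | x ≤ B ∧ ∃ p : ℤ[X], p.natDegree ≤ d ∧ logM p = x}.Finite := by
  refine ((finite_mahlerMeasure_le d ⟨max 1 (exp B), by positivity⟩).image logM).subset ?_
  rintro x ⟨hx, p, hd, rfl⟩
  refine ⟨p, ⟨hd, ?_⟩, rfl⟩
  rcases eq_or_ne p 0 with rfl | hp
  · rw [Polynomial.map_zero, mahlerMeasure_zero]
    exact NNReal.coe_nonneg _
  · refine le_trans ?_ (le_max_right _ _)
    rw [mahlerMeasure, if_pos (map_intCast_complex_ne_zero hp)]
    exact exp_le_exp.2 hx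

lemma logM_eq_of_map_eq_prod {ι : Type*} (s : Finset ι) (f : ι → ℂ) {a : ℤ} (ha : a ≠ 0)
    {p : ℤ[X]} (h : p.map (Int.castRingHom ℂ) = C (a : ℂ) * ∏ i ∈ s, (X - C (f i))) :
    logM p = log ‖(a : ℂ)‖ + ∑ i ∈ s, log⁺ ‖f i‖ := by
  have ha' : (a : ℂ) ≠ 0 := by exact_mod_cast ha
  have hm : (∏ i ∈ s, (X - C (f i))).Monic := monic_prod_of_monic _ _ fun i _ => monic_X_sub_C _
  rw [logM, h, logMahlerMeasure_eq_log_leadingCoeff_add_sum_log_roots, leadingCoeff_mul,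
    hm.leadingCoeff, leadingCoeff_C, mul_one, roots_C_mul _ ha', roots_prod _ _ hm.ne_zero]
  simp

/-- All n roots have modulus |c|^(1/n), so their contributions multiply to max(1, |c|). -/
lemma mahlerMeasure_X_pow_sub_C {n : ℕ} (hn : 0 < n) (c : ℂ) :
    (X ^ n - C c : ℂ[X]).mahlerMeasure = (X - C c : ℂ[X]).mahlerMeasure := by
  have hroot : ∀ b ∈ (X ^ n - C c : ℂ[X]).roots, max 1 ‖b‖ = max 1 (‖c‖ ^ (1 / (n : ℝ))) := by
    intro b hb
    have h := isRoot_of_mem_roots hb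
    have h1 : b ^ n = c := by simpa [sub_eq_zero] using h
    rw [← h1, norm_pow, one_div, pow_rpow_inv_natCast (norm_nonneg _) hn.ne']
  rw [mahlerMeasure_eq_leadingCoeff_mul_prod_roots, mahlerMeasure_eq_leadingCoeff_mul_prod_roots,
    leadingCoeff_X_pow_sub_C hn, Multiset.map_congr rfl hroot]
  have hcard : (X ^ n - C c : ℂ[X]).roots.card = n := by
    rw [splits_iff_card_roots.1 (IsAlgClosed.splits _), natDegree_X_pow_sub_C]
  rw [Multiset.map_const', Multiset.prod_replicate, hcard]
  simp only [roots_X_sub_C, leadingCoeff_X_sub_C, Multiset.map_singleton, Multiset.prod_singleton]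
  congr 1
  rcases le_total ‖c‖ 1 with h | h
  · rw [max_eq_left h, max_eq_left (rpow_le_one (norm_nonneg _) h (by positivity)), one_pow]
  · rw [max_eq_right h, max_eq_right (one_le_rpow h (by positivity)), one_div,
      rpow_inv_natCast_pow (norm_nonneg _) hn.ne']

lemma mahlerMeasure_expand {n : ℕ} (hn : 0 < n) (p : ℂ[X]) :
    (expand ℂ n p).mahlerMeasure = p.mahlerMeasure := by
  have h := (IsAlgClosed.splits p).eq_prod_roots
  nth_rw 1 [h]
  conv_rhs => rw [h]
  rw [map_mul, expand_C, mahlerMeasure_mul, mahlerMeasure_mul, map_multiset_prod,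
    prod_mahlerMeasure_eq_mahlerMeasure_prod, prod_mahlerMeasure_eq_mahlerMeasure_prod,
    Multiset.map_map, Multiset.map_map, Multiset.map_map]
  congr 3
  funext c
  simp [mahlerMeasure_X_pow_sub_C hn]

lemma logM_expand {n : ℕ} (hn : 0 < n) (p : ℤ[X]) : logM (expand ℤ n p) = logM p := by
  rw [logM, logM, map_expand, logMahlerMeasure_eq_log_MahlerMeasure, mahlerMeasure_expand hn,
    ← logMahlerMeasure_eq_log_MahlerMeasure]

/-! ### Integrality of coefficients and of products of roots -/

section Integrality

variable {A E : Type*} [CommRing A] [Field E] [Algebra A E]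

lemma isIntegral_leadingCoeff_mul_root {f : E[X]} (hf : ∀ i, IsIntegral A (f.coeff i)) {x : E}
    (hx : f.eval x = 0) : IsIntegral A (f.leadingCoeff * x) := by
  have hl : f ∈ lifts (algebraMap (integralClosure A E) E) := by
    rw [lifts_iff_coeff_lifts]
    exact fun i => ⟨⟨f.coeff i, hf i⟩, rfl⟩
  obtain ⟨P, hP⟩ := (mem_lifts _).1 hl
  have h0 : aeval x P = 0 := by
    rw [aeval_def, ← eval_map, hP, hx]
  have h1 := isIntegral_leadingCoeff_smul P x h0
  have h2 : P.leadingCoeff • x = f.leadingCoeff * x := by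
    rw [Algebra.smul_def, ← hP,
      leadingCoeff_map_of_injective (FaithfulSMul.algebraMap_injective (integralClosure A E) E)]
  rw [h2] at h1
  exact isIntegral_trans _ h1

/-- Induction on the number of terms of q. Its leading coefficient l is that of the product, and l·x
is integral by the previous lemma, so removing the leading term of q changes the product by integral
coefficients only. -/
lemma isIntegral_coeff_of_X_sub_C_mul (q : E[X]) (x : E)
    (h : ∀ i, IsIntegral A (((X - C x) * q).coeff i)) (i : ℕ) : IsIntegral A (q.coeff i) := by
  induction hn : q.support.card using Nat.strong_induction_on generalizing q i with
  | _ n ih =>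
    rcases eq_or_ne q 0 with rfl | hq
    · simpa using isIntegral_zero
    have hlead : IsIntegral A q.leadingCoeff := by
      have h1 := h ((X - C x) * q).natDegree
      rwa [coeff_natDegree, leadingCoeff_mul, leadingCoeff_X_sub_C, one_mul] at h1
    have hx : IsIntegral A (q.leadingCoeff * x) := by
      have h1 := isIntegral_leadingCoeff_mul_root h (x := x) (by simp)
      rwa [leadingCoeff_mul, leadingCoeff_X_sub_C, one_mul] at h1
    have key : ∀ i, IsIntegral A (((X - C x) * q.eraseLead).coeff i) := by
      intro i
      have e : (X - C x) * q.eraseLead = (X - C x) * q -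
          (monomial (q.natDegree + 1) q.leadingCoeff
            - monomial q.natDegree (q.leadingCoeff * x)) := by
        rw [← self_sub_monomial_natDegree_leadingCoeff]
        simp only [← C_mul_X_pow_eq_monomial, map_mul]
        ring
      rw [e, coeff_sub, coeff_sub, coeff_monomial, coeff_monomial]
      refine (h i).sub (IsIntegral.sub ?_ ?_) <;> split_ifs <;>
        first | assumption | exact isIntegral_zero
    have h2 := fun j => ih _ (by rw [← hn]; exact eraseLead_support_card_lt hq) _ key j rfl
    rw [← eraseLead_add_monomial_natDegree_leadingCoeff q, coeff_add, coeff_monomial]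
    refine (h2 i).add ?_
    split_ifs
    exacts [hlead, isIntegral_zero]

lemma isIntegral_coeff_of_prod_X_sub_C_mul {ι : Type*} (s : Finset ι) (f : ι → E) (q : E[X])
    (h : ∀ i, IsIntegral A (((∏ k ∈ s, (X - C (f k))) * q).coeff i)) (i : ℕ) :
    IsIntegral A (q.coeff i) := by
  classical
  induction s using Finset.induction_on generalizing i with
  | empty => simpa using h i
  | insert k s hk ih =>
    refine ih (isIntegral_coeff_of_X_sub_C_mul _ (f k) fun j => ?_) i
    have := h j
    rwa [Finset.prod_insert hk, mul_assoc] at this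

/-- Cancelling the linear factors outside `t` keeps the coefficients integral; up to sign the
constant term that remains is the claimed product. -/
lemma isIntegral_mul_prod_of_subset {ι : Type*} {s t : Finset ι} (hts : t ⊆ s) (f : ι → E) (a : E)
    (h : ∀ i, IsIntegral A ((C a * ∏ k ∈ s, (X - C (f k))).coeff i)) :
    IsIntegral A (a * ∏ k ∈ t, f k) := by
  classical
  have h1 := isIntegral_coeff_of_prod_X_sub_C_mul (A := A) (s \ t) f
    (C a * ∏ k ∈ t, (X - C (f k))) (fun i => by
      have := h i
      rwa [← Finset.prod_sdiff hts, mul_left_comm] at this) 0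
  rw [coeff_zero_eq_eval_zero, eval_mul, eval_C, eval_prod] at h1
  simp only [eval_sub, eval_X, eval_C, zero_sub, Finset.prod_neg] at h1
  rcases neg_one_pow_eq_or E t.card with h2 | h2 <;> rw [h2] at h1
  · simpa using h1
  · simpa using h1.neg

lemma isIntegral_coeff_C_mul_prod_X_sub_C {ι : Type*} (s : Finset ι) (c : ι → E) (a : E)
    (h : ∀ t ⊆ s, IsIntegral A (a * ∏ k ∈ t, c k)) (i : ℕ) :
    IsIntegral A ((C a * ∏ k ∈ s, (X - C (c k))).coeff i) := by
  classical
  simp only [sub_eq_add_neg X]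
  rw [Finset.prod_add, Finset.mul_sum, finsetSum_coeff]
  refine IsIntegral.sum _ fun t ht => ?_
  have e : C a * ((∏ _k ∈ t, X) * ∏ k ∈ s \ t, -C (c k)) =
      C ((-1) ^ (s \ t).card * (a * ∏ k ∈ s \ t, c k)) * X ^ t.card := by
    simp only [Finset.prod_const, Finset.prod_neg, map_mul, map_pow, map_neg, map_one, map_prod]
    ring
  rw [e, coeff_C_mul, coeff_X_pow]
  refine IsIntegral.mul (IsIntegral.mul (isIntegral_one.neg.pow _) (h _ Finset.sdiff_subset)) ?_
  split_ifs
  exacts [isIntegral_one, isIntegral_zero]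

end Integrality

/-! ### Conjugates grouped into orbits of a normal subgroup -/

section Blocks

open scoped Classical in
/-- The orbit of `x` under a group `H` of automorphisms, as a finite set. -/
noncomputable def orb {E : Type*} [Field E] [Algebra ℚ E] [FiniteDimensional ℚ E]
    (H : Subgroup (E ≃ₐ[ℚ] E)) (x : E) : Finset E :=
  Finset.univ.image fun h : H => (h : E ≃ₐ[ℚ] E) x

open scoped Classical in
/-- The partition of the set of conjugates of `x` into `H`-orbits. -/
noncomputable def blocks {E : Type*} [Field E] [Algebra ℚ E] [FiniteDimensional ℚ E]
    (H : Subgroup (E ≃ₐ[ℚ] E)) (x : E) : Finset (Finset E) :=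
  Finset.univ.image fun σ : E ≃ₐ[ℚ] E => orb H (σ x)

lemma map_prod_block {E : Type*} [Field E] [Algebra ℚ E] [DecidableEq E] (σ : E ≃ₐ[ℚ] E)
    (B : Finset E) : σ (∏ y ∈ B, y) = ∏ y ∈ B.image σ, y := by
  rw [map_prod, Finset.prod_image fun a _ b _ h => σ.injective h]

variable {E : Type*} [Field E] [Algebra ℚ E] [FiniteDimensional ℚ E]
  {H : Subgroup (E ≃ₐ[ℚ] E)}

lemma mem_orb {x y : E} : y ∈ orb H x ↔ ∃ h ∈ H, h x = y := by
  simp [orb]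

lemma mem_blocks {x : E} {B : Finset E} : B ∈ blocks H x ↔ ∃ σ : E ≃ₐ[ℚ] E, orb H (σ x) = B := by
  simp [blocks]

lemma self_mem_orb (x : E) : x ∈ orb H x := mem_orb.2 ⟨1, H.one_mem, rfl⟩

lemma orb_eq_of_mem {x y : E} (h : y ∈ orb H x) : orb H y = orb H x := by
  obtain ⟨g, hg, rfl⟩ := mem_orb.1 h
  ext z
  simp only [mem_orb]
  constructor
  · rintro ⟨k, hk, rfl⟩
    exact ⟨k * g, H.mul_mem hk hg, rfl⟩
  · rintro ⟨k, hk, rfl⟩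
    exact ⟨k * g⁻¹, H.mul_mem hk (H.inv_mem hg), by simp [AlgEquiv.mul_apply]⟩

open scoped Classical in
lemma image_orb [hH : H.Normal] (σ : E ≃ₐ[ℚ] E) (x : E) : (orb H x).image σ = orb H (σ x) := by
  ext z
  simp only [Finset.mem_image, mem_orb]
  constructor
  · rintro ⟨_, ⟨h, hh, rfl⟩, rfl⟩
    exact ⟨σ * h * σ⁻¹, hH.conj_mem h hh σ, by simp [AlgEquiv.mul_apply]⟩
  · rintro ⟨h, hh, rfl⟩
    refine ⟨_, ⟨σ⁻¹ * h * σ, ?_, rfl⟩, by simp [AlgEquiv.mul_apply]⟩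
    simpa using hH.conj_mem h hh σ⁻¹

/-- By normality, the H-orbit of σx depends only on the coset of σ. -/
lemma card_blocks_le [hH : H.Normal] (x : E) : (blocks H x).card ≤ H.index := by
  classical
  have : blocks H x = Finset.univ.image
      fun q : (E ≃ₐ[ℚ] E) ⧸ H => orb H (q.out x) := by
    ext B
    simp only [mem_blocks, Finset.mem_image, Finset.mem_univ, true_and]
    constructor
    · rintro ⟨σ, rfl⟩
      refine ⟨(σ : (E ≃ₐ[ℚ] E) ⧸ H), ?_⟩
      obtain ⟨h, hh⟩ := QuotientGroup.mk_out_eq_mul H σ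
      rw [hh]
      refine orb_eq_of_mem (mem_orb.2 ⟨σ * h * σ⁻¹, hH.conj_mem h h.2 σ, ?_⟩)
      simp [AlgEquiv.mul_apply]
    · rintro ⟨q, rfl⟩
      exact ⟨_, rfl⟩
  rw [this]
  refine Finset.card_image_le.trans ?_
  rw [Finset.card_univ, ← Nat.card_eq_fintype_card]
  rfl

lemma blocks_pairwiseDisjoint (x : E) :
    Set.PairwiseDisjoint (blocks H x : Set (Finset E)) id := by
  intro B hB B' hB' hne
  obtain ⟨σ, rfl⟩ := mem_blocks.1 hB
  obtain ⟨σ', rfl⟩ := mem_blocks.1 hB'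
  refine Finset.disjoint_left.2 fun z hz hz' => hne ?_
  rw [← orb_eq_of_mem hz, ← orb_eq_of_mem hz']

open scoped Classical in
lemma biUnion_blocks (x : E) : (blocks H x).biUnion id = orb ⊤ x := by
  ext z
  simp only [Finset.mem_biUnion, id, mem_blocks, mem_orb, Subgroup.mem_top, true_and]
  constructor
  · rintro ⟨_, ⟨σ, rfl⟩, hz⟩
    obtain ⟨h, -, rfl⟩ := mem_orb.1 hz
    exact ⟨h * σ, rfl⟩
  · rintro ⟨σ, rfl⟩
    exact ⟨_, ⟨σ, rfl⟩, self_mem_orb _⟩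

lemma map_prod_blocks [H.Normal] (σ : E ≃ₐ[ℚ] E) (x : E) :
    (∏ B ∈ blocks H x, (X - C (∏ y ∈ B, y))).map (σ : E →+* E) =
      ∏ B ∈ blocks H x, (X - C (∏ y ∈ B, y)) := by
  classical
  rw [Polynomial.map_prod]
  refine Finset.prod_nbij' (fun B => B.image σ) (fun B => B.image σ.symm) ?_ ?_ ?_ ?_ ?_
  · intro B hB
    obtain ⟨τ, rfl⟩ := mem_blocks.1 hB
    exact mem_blocks.2 ⟨σ * τ, (image_orb σ (τ x)).symm⟩
  · intro B hB
    obtain ⟨τ, rfl⟩ := mem_blocks.1 hB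
    exact mem_blocks.2 ⟨σ.symm * τ, (image_orb σ.symm (τ x)).symm⟩
  · intro B _
    simp [Finset.image_image, Function.comp_def]
  · intro B _
    simp [Finset.image_image, Function.comp_def]
  · intro B _
    rw [← map_prod_block σ B, Polynomial.map_sub, map_X, map_C]
    rfl

/-- The product over a group is a power of the product over the orbit. -/
lemma exists_prod_orb_pow (H : Subgroup (E ≃ₐ[ℚ] E)) [Fintype H] (x : E) :
    ∃ m, (orb H x).card * m = Nat.card H ∧
      (∏ y ∈ orb H x, y) ^ m = ∏ h : H, (h : E ≃ₐ[ℚ] E) x := by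
  classical
  have hmaps : ∀ h ∈ (Finset.univ : Finset H), (h : E ≃ₐ[ℚ] E) x ∈ orb H x :=
    fun h _ => mem_orb.2 ⟨h, h.2, rfl⟩
  -- m is the order of the stabilizer of x; every fibre of h ↦ h x is a coset of it.
  let m := ({h : H | (h : E ≃ₐ[ℚ] E) x = x} : Finset H).card
  have hfib : ∀ y ∈ orb H x, ({h : H | (h : E ≃ₐ[ℚ] E) x = y} : Finset H).card = m := by
    intro y hy
    obtain ⟨g, hg, rfl⟩ := mem_orb.1 hy
    refine Finset.card_nbij' (fun h => (⟨g, hg⟩ : H)⁻¹ * h) (fun h => (⟨g, hg⟩ : H) * h) ?_ ?_ ?_ ?_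
    · intro h hh
      simp only [Finset.coe_filter, Finset.mem_univ, true_and, Set.mem_ofPred_eq] at hh ⊢
      simp [AlgEquiv.mul_apply, hh]
    · intro h hh
      simp only [Finset.coe_filter, Finset.mem_univ, true_and, Set.mem_ofPred_eq] at hh ⊢
      simp [AlgEquiv.mul_apply, hh]
    · intro h _
      simp
    · intro h _
      simp
  refine ⟨m, ?_, ?_⟩
  · rw [Nat.card_eq_fintype_card, ← Finset.card_univ,
      Finset.card_eq_sum_card_fiberwise (t := orb H x) (f := fun h : H => (h : E ≃ₐ[ℚ] E) x)
        (fun h hh => hmaps h hh),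
      Finset.sum_congr rfl hfib, Finset.sum_const, smul_eq_mul]
  · rw [← Finset.prod_fiberwise_of_maps_to hmaps, ← Finset.prod_pow]
    refine Finset.prod_congr rfl fun y hy => ?_
    rw [Finset.prod_congr rfl (g := fun _ => y) (fun h hh => (Finset.mem_filter.1 hh).2),
      Finset.prod_const, hfib y hy]

lemma exists_int_polynomial_of_isIntegral_of_fixed [IsGalois ℚ E] {Q : E[X]}
    (hint : ∀ i, IsIntegral ℤ (Q.coeff i))
    (hfix : ∀ σ : E ≃ₐ[ℚ] E, Q.map (σ : E →+* E) = Q) :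
    ∃ p : ℤ[X], p.map (Int.castRingHom E) = Q := by
  refine (mem_lifts Q).1 ((lifts_iff_coeff_lifts Q).2 fun i => ?_)
  have h1 : Q.coeff i ∈ Set.range (algebraMap ℚ E) := by
    rw [IsGalois.mem_range_algebraMap_iff_fixed]
    intro σ
    have := congrArg (fun q => q.coeff i) (hfix σ)
    simpa using this
  obtain ⟨q, hq⟩ := h1
  have h2 : IsIntegral ℤ q := by
    have := hint i
    rw [← hq] at this
    exact (isIntegral_algebraMap_iff (algebraMap ℚ E).injective).1 this
  obtain ⟨n, hn⟩ := IsIntegrallyClosed.isIntegral_iff.1 h2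
  exact ⟨n, by rw [← hq, ← hn]; simp⟩

/-- Grouping the conjugates of `x` into `H`-orbits and multiplying inside each orbit gives an
integer polynomial of degree at most the index of `H` and of no larger Mahler measure. -/
lemma exists_block_polynomial [IsGalois ℚ E] [H.Normal] (ι : E →+* ℂ) (x : E) {P : ℤ[X]} {a : ℤ}
    (ha : a ≠ 0) (hP : P.map (Int.castRingHom E) = C (a : E) * ∏ y ∈ orb ⊤ x, (X - C y)) :
    ∃ p : ℤ[X], p ≠ 0 ∧ p.natDegree ≤ H.index ∧ logM p ≤ logM P ∧
      ((∀ y ∈ orb ⊤ x, ∀ h ∈ H, ‖ι (h y)‖ = ‖ι y‖) → logM p = logM P) ∧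
      aeval (∏ y ∈ orb H x, y) p = 0 := by
  classical
  have : CharZero E := algebraRat.charZero E
  have hint : ∀ i, IsIntegral ℤ ((C (a : E) * ∏ y ∈ orb ⊤ x, (X - C y)).coeff i) := by
    intro i
    rw [← hP, coeff_map]
    exact isIntegral_algebraMap
  -- A product of block products is a product of distinct conjugates, and a times it is integral.
  -- Automorphisms permute the blocks, so the coefficients are also rational.
  obtain ⟨p, hp⟩ := exists_int_polynomial_of_isIntegral_of_fixed
    (Q := C (a : E) * ∏ B ∈ blocks H x, (X - C (∏ y ∈ B, y)))
    (isIntegral_coeff_C_mul_prod_X_sub_C _ _ _ fun t ht => by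
      rw [show ∏ B ∈ t, ∏ y ∈ B, y = ∏ B ∈ t, ∏ y ∈ id B, y from rfl, ← Finset.prod_biUnion
        ((blocks_pairwiseDisjoint x).subset (by exact_mod_cast ht))]
      refine isIntegral_mul_prod_of_subset ?_ _ _ hint
      rw [← biUnion_blocks (H := H) x]
      exact Finset.biUnion_subset_biUnion_of_subset_left _ ht)
    (fun σ => by
      rw [Polynomial.map_mul, map_prod_blocks]
      simp)
  have hmon : (∏ B ∈ blocks H x, (X - C (∏ y ∈ B, y))).Monic :=
    monic_prod_of_monic _ _ fun B _ => monic_X_sub_C _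
  have haE : (a : E) ≠ 0 := by exact_mod_cast ha
  have hι : ι.comp (Int.castRingHom E) = Int.castRingHom ℂ := RingHom.ext_int _ _
  have hMp : logM p = log ‖(a : ℂ)‖ + ∑ B ∈ blocks H x, log⁺ ‖ι (∏ y ∈ B, y)‖ := by
    refine logM_eq_of_map_eq_prod _ _ ha ?_
    rw [← hι, ← Polynomial.map_map, hp, Polynomial.map_mul, Polynomial.map_prod]
    simp only [Polynomial.map_sub, map_X, map_C, _root_.map_intCast, Polynomial.map_intCast]
  have hMP : logM P = log ‖(a : ℂ)‖ + ∑ B ∈ blocks H x, ∑ y ∈ B, log⁺ ‖ι y‖ := by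
    rw [logM_eq_of_map_eq_prod (orb ⊤ x) ι ha (p := P), ← biUnion_blocks (H := H) x,
      Finset.sum_biUnion (blocks_pairwiseDisjoint x)]
    · rfl
    · rw [← hι, ← Polynomial.map_map, hP, Polynomial.map_mul, Polynomial.map_prod]
      simp
  refine ⟨p, ?_, ?_, ?_, ?_, ?_⟩
  · rintro rfl
    rw [Polynomial.map_zero] at hp
    exact mul_ne_zero (C_ne_zero.2 haE) hmon.ne_zero hp.symm
  · rw [← natDegree_map_eq_of_injective (Int.castRingHom E).injective_int p, hp,
      natDegree_C_mul haE, natDegree_prod_of_monic _ _ fun B _ => monic_X_sub_C _]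
    simp only [natDegree_X_sub_C, Finset.sum_const, smul_eq_mul, mul_one]
    exact card_blocks_le x
  · rw [hMp, hMP]
    gcongr with B hB
    rw [map_prod, norm_prod]
    exact posLog_prod _ _
  -- If the modulus is constant on each block, log⁺ of the block product equals the sum of the
  -- log⁺'s.
  · intro hc
    rw [hMp, hMP]
    congr 1
    refine Finset.sum_congr rfl fun B hB => ?_
    obtain ⟨σ, rfl⟩ := mem_blocks.1 hB
    have hn : ∀ y ∈ orb H (σ x), ‖ι y‖ = ‖ι (σ x)‖ := by
      intro y hy
      obtain ⟨h, hh, rfl⟩ := mem_orb.1 hy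
      exact hc _ (mem_orb.2 ⟨σ, Subgroup.mem_top _, rfl⟩) h hh
    rw [map_prod, norm_prod, Finset.prod_congr rfl hn,
      Finset.sum_congr rfl fun y hy => by rw [hn y hy]]
    simp
  · have : (p.map (Int.castRingHom E)).eval (∏ y ∈ orb H x, y) = 0 := by
      rw [hp, eval_mul, eval_prod,
        Finset.prod_eq_zero (mem_blocks.2 ⟨1, rfl⟩) (by
          rw [eval_sub, eval_X, eval_C, AlgEquiv.one_apply, sub_self]), mul_zero]
    rwa [eval_map] at this

end Blocks

/-! ### Integer minimal polynomials and radicals of norms -/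

lemma intMinpoly_isPrimitive (α : ℂ) : (intMinpoly α).IsPrimitive := isPrimitive_primPart _

lemma intMinpoly_map {α : ℂ} (hα : IsIntegral ℚ α) :
    ∃ b : ℚ, b ≠ 0 ∧ (intMinpoly α).map (Int.castRingHom ℚ) = C b * minpoly ℚ α := by
  set N := IsLocalization.integerNormalization ℤ⁰ (minpoly ℚ α) with hN
  obtain ⟨d, hd, hd'⟩ := IsLocalization.integerNormalization_spec ℤ⁰ (minpoly ℚ α)
  have hN0 : N ≠ 0 := by
    rw [hN, Ne, IsFractionRing.integerNormalization_eq_zero_iff]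
    exact minpoly.ne_zero hα
  have hc : (N.content : ℚ) ≠ 0 := by
    exact_mod_cast fun h => hN0 (content_eq_zero_iff.1 h)
  have hd0 : (d : ℚ) ≠ 0 := by exact_mod_cast nonZeroDivisors.ne_zero hd
  refine ⟨d / N.content, div_ne_zero hd0 hc, ?_⟩
  have h1 : C (N.content : ℚ) * (intMinpoly α).map (Int.castRingHom ℚ) =
      C (d : ℚ) * minpoly ℚ α := by
    have h2 := congrArg (Polynomial.map (Int.castRingHom ℚ)) N.eq_C_content_mul_primPart
    rw [Polynomial.map_mul, map_C] at h2
    refine Eq.trans h2.symm (hd'.trans ?_)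
    ext i
    simp
  apply mul_left_cancel₀ (C_ne_zero.2 hc)
  rw [h1, ← mul_assoc, ← C_mul, mul_div_cancel₀ _ hc]

lemma intMinpoly_dvd {α : ℂ} (hα : IsIntegral ℚ α) {p : ℤ[X]} (hp : aeval α p = 0) :
    intMinpoly α ∣ p := by
  rw [IsPrimitive.Int.dvd_iff_map_cast_dvd_map_cast _ _ (intMinpoly_isPrimitive α)]
  obtain ⟨b, hb, h⟩ := intMinpoly_map hα
  rw [h, (isUnit_C.2 hb.isUnit).mul_left_dvd]
  refine minpoly.dvd ℚ α ?_
  have : aeval α (p.map (algebraMap ℤ ℚ)) = 0 := by rw [aeval_map_algebraMap, hp]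
  exact this

lemma isIntegral_coe (β : QBarˣ) : IsIntegral ℚ ((β : QBar) : ℂ) :=
  ((mem_algebraicClosure_iff).1 (β : QBar).2).isIntegral

lemma M_eq_logM (β : QBarˣ) : M β = logM (intMinpoly ((β : QBar) : ℂ)) := rfl

lemma M_nonneg (β : QBarˣ) : 0 ≤ M β := logM_nonneg _

/-- A root of `p(X ^ L)` has Mahler measure at most that of `p`. -/
lemma M_le_of_aeval_pow {β : QBarˣ} {p : ℤ[X]} (hp : p ≠ 0) {L : ℕ} (hL : 0 < L)
    (h : aeval (((β : QBar) : ℂ) ^ L) p = 0) : M β ≤ logM p := by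
  rw [← logM_expand hL p]
  refine logM_le_of_dvd ((expand_ne_zero hL).2 hp) (intMinpoly_dvd (isIntegral_coe β) ?_)
  rwa [expand_aeval]

lemma M_eq_zero_of_pow_eq_one {β : QBarˣ} {L : ℕ} (hL : 0 < L) (h : β ^ L = 1) : M β = 0 := by
  refine le_antisymm ?_ (M_nonneg β)
  have h1 : ((β : QBar) : ℂ) ^ L = 1 := by
    simpa using congrArg (fun x : QBarˣ => ((x : QBar) : ℂ)) h
  refine (M_le_of_aeval_pow (p := X - 1) (X_sub_C_ne_zero 1) hL (by simp [h1])).trans_eq ?_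
  have := logMahlerMeasure_X_sub_C 1
  simpa [logM] using this

lemma minpoly_map_eq_prod_orb {E : Type*} [Field E] [Algebra ℚ E] [FiniteDimensional ℚ E]
    [IsGalois ℚ E] (x : E) :
    (minpoly ℚ x).map (algebraMap ℚ E) = ∏ y ∈ orb ⊤ x, (X - C y) := by
  classical
  have hs := (Normal.splits (F := ℚ) inferInstance x).eq_prod_roots
  have hnd : ((minpoly ℚ x).map (algebraMap ℚ E)).roots.Nodup :=
    nodup_roots (Polynomial.Separable.map (IsGalois.separable ℚ x))
  have hint : IsIntegral ℚ x := IsIntegral.of_finite ℚ x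
  have hr : ((minpoly ℚ x).map (algebraMap ℚ E)).roots.toFinset = orb ⊤ x := by
    ext y
    rw [Multiset.mem_toFinset, mem_roots_map (minpoly.ne_zero hint), mem_orb, ← aeval_def]
    constructor
    · intro h
      obtain ⟨σ, hσ⟩ := minpoly.exists_algEquiv_of_root' hint.isAlgebraic h
      exact ⟨σ, Subgroup.mem_top _, hσ⟩
    · rintro ⟨σ, -, rfl⟩
      rw [aeval_algHom_apply, minpoly.aeval, map_zero]
  rw [hs, ((minpoly.monic hint).map _).leadingCoeff, C_1, one_mul, ← hr, Finset.prod,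
    Multiset.toFinset_val, hnd.dedup]

lemma exists_block_polynomial_intMinpoly {E : Type*} [Field E] [Algebra ℚ E]
    [FiniteDimensional ℚ E] [IsGalois ℚ E] (ι : E →ₐ[ℚ] ℂ) (H : Subgroup (E ≃ₐ[ℚ] E)) [H.Normal]
    (γ : QBarˣ) (x : E) (hx : ι x = (γ : QBar)) :
    ∃ p : ℤ[X], p ≠ 0 ∧ p.natDegree ≤ H.index ∧ logM p ≤ M γ ∧
      ((∀ y ∈ orb ⊤ x, ∀ h ∈ H, ‖ι (h y)‖ = ‖ι y‖) → logM p = M γ) ∧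
      aeval (ι (∏ y ∈ orb H x, y)) p = 0 := by
  obtain ⟨b, hb, h⟩ := intMinpoly_map (isIntegral_coe γ)
  rw [← hx, minpoly.algHom_eq ι ι.injective] at h
  have hmon : (minpoly ℚ x).Monic := minpoly.monic (IsIntegral.of_finite ℚ x)
  have hlead : b = ((intMinpoly (ι x)).leadingCoeff : ℚ) := by
    have := congrArg leadingCoeff h
    rw [leadingCoeff_map_of_injective (Int.castRingHom ℚ).injective_int, leadingCoeff_mul,
      hmon.leadingCoeff, leadingCoeff_C, mul_one] at this
    exact this.symm
  have hP : (intMinpoly (ι x)).map (Int.castRingHom E) =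
      C (((intMinpoly (ι x)).leadingCoeff : ℤ) : E) * ∏ y ∈ orb ⊤ x, (X - C y) := by
    have hcomp : (algebraMap ℚ E).comp (Int.castRingHom ℚ) = Int.castRingHom E :=
      RingHom.ext_int _ _
    rw [← minpoly_map_eq_prod_orb, ← hcomp, ← Polynomial.map_map, h, Polynomial.map_mul, map_C,
      hlead, _root_.map_intCast]
  obtain ⟨p, h0, h1, h2, h3, h4⟩ := exists_block_polynomial (H := H) (ι : E →+* ℂ) x
    (leadingCoeff_ne_zero.2 (intMinpoly_isPrimitive _).ne_zero) hP
  rw [M_eq_logM, ← hx]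
  refine ⟨p, h0, h1, h2, h3, ?_⟩
  have hcomp : (ι : E →+* ℂ).comp (algebraMap ℤ E) = algebraMap ℤ ℂ := RingHom.ext_int _ _
  rw [aeval_def] at h4 ⊢
  rw [← hcomp]
  refine (hom_eval₂ p (algebraMap ℤ E) (ι : E →+* ℂ) _).symm.trans ?_
  rw [h4, map_zero]

/-- Each `γ` can be replaced by a radical of its relative norm, without increasing `M`. -/
lemma exists_radical_of_norm {E : Type*} [Field E] [Algebra ℚ E]
    [FiniteDimensional ℚ E] [IsGalois ℚ E] (ι : E →ₐ[ℚ] ℂ) (H : Subgroup (E ≃ₐ[ℚ] E)) [H.Normal]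
    [Fintype H] (γ : QBarˣ) (x : E) (hx : ι x = (γ : QBar)) :
    ∃ β : QBarˣ, M β ≤ M γ ∧
      ((β : QBar) : ℂ) ^ Nat.card H = ι (∏ h : H, (h : E ≃ₐ[ℚ] E) x) := by
  obtain ⟨p, h0, -, h2, -, h4⟩ := exists_block_polynomial_intMinpoly ι H γ x hx
  obtain ⟨m, hm, hprod⟩ := exists_prod_orb_pow H x
  set c : E := ∏ y ∈ orb H x, y with hc
  have hL : 0 < (orb H x).card := Finset.card_pos.2 ⟨x, self_mem_orb x⟩
  have hx0 : x ≠ 0 := by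
    rintro rfl
    exact γ.ne_zero (Subtype.ext (by simpa using hx.symm))
  have hc0 : c ≠ 0 := by
    refine Finset.prod_ne_zero_iff.2 fun y hy => ?_
    obtain ⟨h, -, rfl⟩ := mem_orb.1 hy
    simpa using hx0
  -- A root of the orbit product of order |orbit| suffices: the norm is the m-th power of that
  -- product and |orbit|·m = |H|.
  obtain ⟨b, hb⟩ := IsAlgClosed.exists_pow_nat_eq (ι c) hL
  have hbalg : IsAlgebraic ℚ b := by
    refine IsAlgebraic.of_pow hL ?_
    rw [hb]
    exact ((IsIntegral.of_finite ℚ c).map ι).isAlgebraic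
  have hb0 : b ≠ 0 := by
    rintro rfl
    rw [zero_pow hL.ne'] at hb
    exact hc0 ((map_eq_zero ι).1 hb.symm)
  refine ⟨Units.mk0 ⟨b, mem_algebraicClosure_iff.2 hbalg⟩ (fun h => hb0 (congrArg Subtype.val h)),
    (M_le_of_aeval_pow h0 hL ?_).trans h2, ?_⟩
  · simpa only [Units.val_mk0, hb] using h4
  · simp only [Units.val_mk0]
    rw [← hm, pow_mul, hb, ← hprod, map_pow]

/-! ### Reduction to radicals over a fixed normal field -/

lemma exists_normal_field {F L : Type*} [Field F] [Field L] [Algebra F L] [IsAlgClosed L]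
    (K : IntermediateField F L) [FiniteDimensional F K] [Normal F K]
    (s : Finset L) (hs : ∀ x ∈ s, IsIntegral F x) :
    ∃ E : IntermediateField F L, K ≤ E ∧ FiniteDimensional F E ∧ Normal F E ∧ ∀ x ∈ s, x ∈ E := by
  let p : F[X] := ∏ x ∈ s, minpoly F x
  let N := IntermediateField.adjoin F (p.rootSet L)
  have hp : p.IsSplittingField F N :=
    IntermediateField.adjoin_rootSet_isSplittingField (IsAlgClosed.splits _)
  have h1 : Normal F N := Normal.of_isSplittingField p
  have h2 : FiniteDimensional F N := IsSplittingField.finiteDimensional N p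
  have hp0 : p ≠ 0 := Finset.prod_ne_zero_iff.2 fun x hx => minpoly.ne_zero (hs x hx)
  refine ⟨K ⊔ N, le_sup_left, inferInstance, inferInstance, fun x hx => ?_⟩
  refine (le_sup_right : N ≤ K ⊔ N) (IntermediateField.subset_adjoin _ _ ?_)
  rw [mem_rootSet]
  refine ⟨hp0, ?_⟩
  rw [map_prod]
  exact Finset.prod_eq_zero hx (minpoly.aeval F x)

lemma exists_galois_field {F L : Type*} [Field F] [CharZero F] [Field L] [Algebra F L]
    [IsAlgClosed L] (K : IntermediateField F L) [FiniteDimensional F K] [Normal F K]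
    (s : Finset L) (hs : ∀ x ∈ s, IsIntegral F x) :
    ∃ (E : IntermediateField F L) (_ : FiniteDimensional F E) (_ : IsGalois F E)
      (H : Subgroup (E ≃ₐ[F] E)), H.Normal ∧ H.index = Module.finrank F K ∧ (∀ x ∈ s, x ∈ E) ∧
        ∀ z : E, (z : L) ∈ K ↔ ∀ h ∈ H, h z = z := by
  obtain ⟨E, hKE, hfd, hnor, hsE⟩ := exists_normal_field K s hs
  have hgal : IsGalois F E := ⟨⟩
  let K' : IntermediateField F E := IntermediateField.restrict hKE
  let e : K ≃ₐ[F] K' := IntermediateField.restrictAlgEquiv hKE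
  have hK' : Normal F K' := Normal.of_algEquiv e
  refine ⟨E, hfd, hgal, K'.fixingSubgroup, ?_, ?_, hsE, fun z => ?_⟩
  · rw [← IntermediateField.restrictNormalHom_ker]
    infer_instance
  · rw [← IntermediateField.finrank_eq_fixingSubgroup_index]
    exact e.toLinearEquiv.finrank_eq.symm
  · rw [← IntermediateField.mem_restrict hKE z]
    change z ∈ K' ↔ _
    conv_lhs => rw [← IsGalois.fixedField_fixingSubgroup K', IntermediateField.mem_fixedField_iff]

/-- Every finite set of algebraic numbers lies in a finite Galois extension `E` of `ℚ` in which
the elements of `K` are those fixed by a normal subgroup of index `d`. -/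
def IsGaloisSubfield (K : Set ℂ) (d : ℕ) : Prop :=
  ∀ s : Finset ℂ, (∀ x ∈ s, IsIntegral ℚ x) →
    ∃ (E : Type) (_ : Field E) (_ : Algebra ℚ E) (_ : FiniteDimensional ℚ E) (_ : IsGalois ℚ E)
      (ι : E →ₐ[ℚ] ℂ) (H : Subgroup (E ≃ₐ[ℚ] E)), H.Normal ∧ H.index = d ∧
        (∀ x ∈ s, ∃ y, ι y = x) ∧ ∀ z : E, ι z ∈ K ↔ ∀ h ∈ H, h z = z

lemma exists_isGaloisSubfield {a : ℂ} (ha : IsIntegral ℚ a) :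
    ∃ (K : Set ℂ) (d : ℕ), IsGaloisSubfield K d ∧ a ∈ K := by
  obtain ⟨K, -, hfd, hnor, ha'⟩ :=
    exists_normal_field (⊥ : IntermediateField ℚ ℂ) {a} (by simpa using ha)
  refine ⟨K, Module.finrank ℚ K, fun s hs => ?_, ha' a (by simp)⟩
  obtain ⟨E, h1, h2, H, h3, h4, h5, h6⟩ := exists_galois_field K s hs
  exact ⟨E, inferInstance, _, h1, h2, E.val, H, h3, h4, fun x hx => ⟨⟨x, h5 x hx⟩, rfl⟩, h6⟩

/-- Radicals over `K` have the Mahler measure of an integer polynomial of bounded degree. -/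
lemma exists_logM_eq_of_pow_mem {K : Set ℂ} {d : ℕ} (hK : IsGaloisSubfield K d) {β : QBarˣ}
    {r : ℕ} (hr : 0 < r) (hβ : ((β : QBar) : ℂ) ^ r ∈ K) :
    ∃ p : ℤ[X], p.natDegree ≤ d ∧ logM p = M β := by
  obtain ⟨E, _, _, _, _, ι, H, hn, hi, hs, hfix⟩ := hK {((β : QBar) : ℂ)}
    (by simpa using isIntegral_coe β)
  obtain ⟨x, hx⟩ := hs _ (Finset.mem_singleton_self _)
  obtain ⟨p, -, h1, -, h3, -⟩ := exists_block_polynomial_intMinpoly ι H β x hx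
  refine ⟨p, h1.trans_eq hi, h3 fun y hy h hh => ?_⟩
  obtain ⟨σ, -, rfl⟩ := mem_orb.1 hy
  have hxr : ∀ g ∈ H, g (x ^ r) = x ^ r := by
    rw [← hfix, map_pow, hx]
    exact hβ
  -- By normality conjugates of x^r are also fixed by H, so h preserves the modulus of each
  -- conjugate of x: the equality case for blocks.
  have hc : h (σ (x ^ r)) = σ (x ^ r) := by
    have h1 := hxr _ (hn.conj_mem h hh σ⁻¹)
    have h2 := congrArg σ h1
    simpa [AlgEquiv.mul_apply] using h2
  have hpow : ‖ι (h (σ x))‖ ^ r = ‖ι (σ x)‖ ^ r := by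
    rw [← norm_pow, ← norm_pow, ← map_pow, ← map_pow, ← map_pow, ← map_pow,
      ← map_pow, hc]
  exact (pow_left_inj₀ (norm_nonneg _) (norm_nonneg _) hr.ne').1 hpow

/-- Any factorization of `α ∈ K` can be replaced by one into radicals over `K`, without increasing
the Mahler measures of the factors. -/
lemma exists_radical_factorization {K : Set ℂ} {d : ℕ} (hK : IsGaloisSubfield K d) {α : QBarˣ}
    (hα : ((α : QBar) : ℂ) ∈ K) (a : FinSeq QBarˣ) (ha : tau a = α) :
    ∃ b : FinSeq QBarˣ, tau b = α ∧
      ∀ n, M (b.1 n) ≤ M (a.1 n) ∧ ∃ r, 0 < r ∧ (((b.1 n : QBarˣ) : QBar) : ℂ) ^ r ∈ K := by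
  classical
  let S : Finset ℕ := a.2.toFinset
  obtain ⟨E, _, _, _, _, ι, H, hn, hi, hs, hfix⟩ := hK
    (insert ((α : QBar) : ℂ) (S.image fun n => ((a.1 n : QBar) : ℂ))) (by
      intro x hx
      rcases Finset.mem_insert.1 hx with rfl | hx
      · exact isIntegral_coe α
      · obtain ⟨n, -, rfl⟩ := Finset.mem_image.1 hx
        exact isIntegral_coe _)
  have : Fintype H := Fintype.ofFinite H
  have hx : ∀ n, ∃ x : E, ι x = (a.1 n : QBar) := by
    intro n
    by_cases hnS : n ∈ S
    · exact hs _ (Finset.mem_insert_of_mem (Finset.mem_image_of_mem _ hnS))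
    · have h1 : a.1 n = 1 := by simpa [S] using hnS
      exact ⟨1, by simp [h1]⟩
  choose x hx using hx
  choose β hβ hβpow using fun n => exists_radical_of_norm ι H (a.1 n) (x n) (hx n)
  obtain ⟨z, hz⟩ := hs _ (Finset.mem_insert_self _ _)
  have hc : 0 < Nat.card H := Nat.card_pos
  have hprod : ∏ n ∈ S, x n = z := by
    refine RingHom.injective (ι : E →+* ℂ) ?_
    change ι _ = ι _
    rw [map_prod, hz, ← ha, tau, finprod_eq_prod_of_mulSupport_subset (s := S) _ (by simp [S])]
    simp [hx]
  have hfixed : ∀ n, ι (∏ h : H, (h : E ≃ₐ[ℚ] E) (x n)) ∈ K := by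
    intro n
    rw [hfix]
    intro g hg
    rw [map_prod]
    exact Fintype.prod_equiv (Equiv.mulLeft (⟨g, hg⟩ : H)) _ _ fun h => rfl
  have hzK : ∀ h ∈ H, h z = z := by rw [← hfix, hz]; exact hα
  -- Both sides are the norm of α, since H fixes α.
  have hpow : (∏ n ∈ S, β n) ^ Nat.card H = α ^ Nat.card H := by
    apply Units.ext
    apply Subtype.ext
    have h1 : ((((∏ n ∈ S, β n) ^ Nat.card H : QBarˣ) : QBar) : ℂ) =
        ∏ n ∈ S, ((β n : QBar) : ℂ) ^ Nat.card H := by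
      simp [Finset.prod_pow]
    rw [h1, Finset.prod_congr rfl fun n _ => hβpow n, ← map_prod, Finset.prod_comm]
    simp_rw [← map_prod, hprod]
    rw [Finset.prod_congr rfl fun (h : H) _ => hzK h h.2]
    simp [hz]
  -- An unused index, to hold the root of unity ζ.
  obtain ⟨m, hm⟩ := S.exists_notMem
  let ζ : QBarˣ := α * (∏ n ∈ S, β n)⁻¹
  have hζ : ζ ^ Nat.card H = 1 := by
    rw [mul_pow, inv_pow, hpow, mul_inv_cancel]
  have hK1 : (1 : ℂ) ∈ K := by
    have := (hfix 1).2 fun h _ => map_one h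
    rwa [map_one] at this
  let b : ℕ → QBarˣ := fun n => if n ∈ S then β n else if n = m then ζ else 1
  have hb : Function.mulSupport b ⊆ (insert m S : Finset ℕ) := by
    intro n hn
    rw [Finset.mem_coe, Finset.mem_insert]
    by_contra! h
    exact hn (by simp [b, h.1, h.2])
  have hM1 : ∀ {u : QBarˣ}, u ^ Nat.card H = 1 → ∀ n, M u ≤ M (a.1 n) := fun hu n =>
    (M_eq_zero_of_pow_eq_one hc hu).trans_le (M_nonneg _)
  refine ⟨⟨b, (Finset.finite_toSet _).subset hb⟩, ?_, fun n => ?_⟩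
  · change ∏ᶠ n, b n = α
    rw [finprod_eq_prod_of_mulSupport_subset _ hb, Finset.prod_insert hm,
      Finset.prod_congr rfl (g := β) fun n hn => if_pos hn]
    simp [b, hm, ζ]
  · by_cases h1 : n ∈ S
    · simp only [b, if_pos h1]
      exact ⟨hβ n, _, hc, by rw [hβpow]; exact hfixed n⟩
    · by_cases h2 : n = m
      · simp only [b, if_neg h1, if_pos h2]
        refine ⟨hM1 hζ n, _, hc, ?_⟩
        have : ((ζ : QBar) : ℂ) ^ Nat.card H = 1 := by
          simpa using congrArg (fun x : QBarˣ => ((x : QBar) : ℂ)) hζ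
        rwa [this]
      · simp only [b, if_neg h1, if_neg h2]
        exact ⟨hM1 (one_pow _) n, 1, one_pos, by simpa using hK1⟩

end MetricMahler

namespace MetricMahler

/-! ### Power sums as functions of the exponent -/

open Filter Topology

/-- The sum of the `t`-th powers of the non-zero entries of a finitely supported sequence. -/
noncomputable def powSum (x : ℕ →₀ ℝ) (t : ℝ) : ℝ := ∑ n ∈ x.support, x n ^ t

lemma powSum_eq_sum (x : ℕ →₀ ℝ) {t : ℝ} (ht : t ≠ 0) {S : Finset ℕ} (hS : x.support ⊆ S) :
    powSum x t = ∑ n ∈ S, x n ^ t :=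
  Finset.sum_subset hS fun n _ hn => by
    rw [Finsupp.notMem_support_iff.1 hn, Real.zero_rpow ht]

lemma powSum_nonneg {x : ℕ →₀ ℝ} (hx : ∀ n, 0 ≤ x n) (t : ℝ) : 0 ≤ powSum x t :=
  Finset.sum_nonneg fun n _ => Real.rpow_nonneg (hx n) t

lemma powSum_mono {x y : ℕ →₀ ℝ} (hx : ∀ n, 0 ≤ x n) (h : ∀ n, x n ≤ y n) {t : ℝ} (ht : 0 < t) :
    powSum x t ≤ powSum y t := by
  rw [powSum_eq_sum x ht.ne' (Finset.subset_union_left (s₂ := y.support)),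
    powSum_eq_sum y ht.ne' (Finset.subset_union_right (s₁ := x.support))]
  exact Finset.sum_le_sum fun n _ => Real.rpow_le_rpow (hx n) (h n) ht.le

lemma rpow_le_powSum {x : ℕ →₀ ℝ} (hx : ∀ n, 0 ≤ x n) {t : ℝ} (ht : 0 < t) (n : ℕ) :
    x n ^ t ≤ powSum x t := by
  rw [powSum_eq_sum x ht.ne' (Finset.subset_insert n x.support)]
  exact Finset.single_le_sum (f := fun n => x n ^ t) (fun n _ => Real.rpow_nonneg (hx n) t)
    (Finset.mem_insert_self _ _)

lemma tNorm_ofReal {x : ℕ →₀ ℝ} (hx : ∀ n, 0 ≤ x n) {t : ℝ} (ht : 0 < t) :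
    tNorm (ENNReal.ofReal t) x = powSum x t ^ (1 / t) := by
  rw [tNorm, if_neg ENNReal.ofReal_ne_top, ENNReal.toReal_ofReal ht.le,
    finsum_eq_sum_of_support_subset (s := x.support), powSum]
  · simp only [abs_of_nonneg (hx _)]
  · intro n hn
    rw [Finset.mem_coe, Finsupp.mem_support_iff]
    intro h
    exact hn (by simp [h, ht.ne'])

/-- Summing over the support keeps all bases positive, so each term is exp(t log x), analytic even
at t = 0. -/
lemma analyticAt_powSum {x : ℕ →₀ ℝ} (hx : ∀ n, 0 ≤ x n) (t : ℝ) :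
    AnalyticAt ℝ (powSum x) t := by
  unfold powSum
  refine Finset.analyticAt_fun_sum _ fun n hn => ?_
  have hpos : 0 < x n := (hx n).lt_of_ne' (Finsupp.mem_support_iff.1 hn)
  change AnalyticAt ℝ (fun t => x n ^ t) t
  simp only [Real.rpow_def_of_pos hpos]
  fun_prop

lemma powSum_eq_sum_card {x : ℕ →₀ ℝ} {V : Finset ℝ} (hV : ∀ n ∈ x.support, x n ∈ V) (t : ℝ) :
    powSum x t = ∑ v : V, (({n ∈ x.support | x n = v} : Finset ℕ).card : ℝ) * (v : ℝ) ^ t := by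
  rw [powSum, ← Finset.sum_fiberwise_of_maps_to hV,
    ← Finset.sum_coe_sort V (fun v => ∑ n ∈ x.support with x n = v, x n ^ t)]
  refine Finset.sum_congr rfl fun v _ => ?_
  rw [Finset.sum_congr rfl (g := fun _ => (v : ℝ) ^ t)
    (fun n hn => by rw [(Finset.mem_filter.1 hn).2]), Finset.sum_const, nsmul_eq_mul]

/-- A power sum is determined by the multiplicities of the values in `V`, each between 0 and `N`. -/
lemma finite_powSum (V : Finset ℝ) (N : ℕ) :
    {f : ℝ → ℝ | ∃ x : ℕ →₀ ℝ, (∀ n ∈ x.support, x n ∈ V) ∧ x.support.card ≤ N ∧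
      powSum x = f}.Finite := by
  refine (Set.finite_range fun (m : V → Fin (N + 1)) (t : ℝ) =>
    ∑ v : V, ((m v : ℕ) : ℝ) * (v : ℝ) ^ t).subset ?_
  rintro f ⟨x, hV, hN, rfl⟩
  refine ⟨fun v => ⟨({n ∈ x.support | x n = v} : Finset ℕ).card,
    Nat.lt_succ_of_le ((Finset.card_filter_le _ _).trans hN)⟩, ?_⟩
  funext t
  exact (powSum_eq_sum_card hV t).symm

/-- Each non-zero entry contributes at least δ^t. The maximum with 1 lets the exponent grow from t
to T, making the bound uniform in t. -/
lemma card_support_le {x : ℕ →₀ ℝ} {C δ t T : ℝ} (hδ : 0 < δ) (hC : 0 ≤ C) (ht : 0 < t)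
    (htT : t ≤ T) (hx : ∀ n ∈ x.support, δ ≤ x n) (hsum : powSum x t ≤ C ^ t) :
    (x.support.card : ℝ) ≤ max 1 (C / δ) ^ T := by
  have h1 : (x.support.card : ℝ) * δ ^ t ≤ C ^ t := by
    refine le_trans ?_ hsum
    rw [← nsmul_eq_mul, ← Finset.sum_const]
    exact Finset.sum_le_sum fun n hn => Real.rpow_le_rpow hδ.le (hx n hn) ht.le
  calc (x.support.card : ℝ) ≤ C ^ t / δ ^ t := (le_div_iff₀ (Real.rpow_pos_of_pos hδ t)).2 h1
    _ = (C / δ) ^ t := (Real.div_rpow hC hδ.le t).symm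
    _ ≤ max 1 (C / δ) ^ t := Real.rpow_le_rpow (by positivity) (le_max_right _ _) ht.le
    _ ≤ max 1 (C / δ) ^ T := Real.rpow_le_rpow_of_exponent_le (le_max_left _ _) htT

/-- Identity theorem: the zeros of f - g form a closed discrete set, which meets a compact interval
in finitely many points. -/
lemma finite_coincidences {f g : ℝ → ℝ} (hf : ∀ t, AnalyticAt ℝ f t) (hg : ∀ t, AnalyticAt ℝ g t)
    (hne : f ≠ g) (T : ℝ) : {t ∈ Set.Icc 0 T | f t = g t}.Finite := by
  obtain ⟨t₀, ht₀⟩ := Function.ne_iff.1 hne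
  have han : AnalyticOnNhd ℝ (fun t => f t - g t) Set.univ := fun t _ => (hf t).sub (hg t)
  have hcod := han.preimage_zero_mem_codiscrete (x := t₀) (sub_ne_zero.2 ht₀)
  obtain ⟨hopen, hdisc⟩ := mem_codiscrete'.1 hcod
  have hset : {t ∈ Set.Icc 0 T | f t = g t} =
      Set.Icc 0 T ∩ ((fun t => f t - g t) ⁻¹' {0}ᶜ)ᶜ := by
    ext t
    simp [sub_eq_zero]
  rw [hset]
  exact (isCompact_Icc.inter_right hopen.isClosed_compl).finite (hdisc.mono Set.inter_subset_right)

/-! ### Minimizing factorizations for a general height -/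

section MetricVersion

variable {G : Type*} [CommGroup G] {φ : G → ℝ}

/-- The heights of the entries of a sequence. -/
noncomputable def heights (hφ1 : φ 1 = 0) (a : FinSeq G) : ℕ →₀ ℝ :=
  Finsupp.ofSupportFinite (fun n => φ (a.1 n)) (a.2.subset fun n hn h => hn (by simp [h, hφ1]))

lemma heights_apply (hφ1 : φ 1 = 0) (a : FinSeq G) (n : ℕ) : heights hφ1 a n = φ (a.1 n) := rfl

/-- The sequence `g, 1, 1, …`. -/
def singleSeq (g : G) : FinSeq G :=
  ⟨Pi.mulSingle 0 g, (Set.finite_singleton 0).subset Pi.mulSupport_mulSingle_subset⟩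

lemma tau_singleSeq (g : G) : tau (singleSeq g) = g := by
  change ∏ᶠ n, (Pi.mulSingle 0 g : ℕ → G) n = g
  rw [finprod_eq_single _ 0 fun n hn => by simp [hn], Pi.mulSingle_eq_same]

lemma support_heights_singleSeq (hφ1 : φ 1 = 0) (g : G) :
    (heights hφ1 (singleSeq g)).support ⊆ {0} := by
  intro n hn
  rw [Finset.mem_singleton]
  by_contra h
  refine Finsupp.mem_support_iff.1 hn ?_
  rw [heights_apply]
  simp [singleSeq, Pi.mulSingle_eq_of_ne h, hφ1]

lemma heights_singleSeq_zero (hφ1 : φ 1 = 0) (g : G) : heights hφ1 (singleSeq g) 0 = φ g := by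
  rw [heights_apply]
  simp [singleSeq]

lemma powSum_singleSeq (hφ1 : φ 1 = 0) (g : G) {t : ℝ} (ht : t ≠ 0) :
    powSum (heights hφ1 (singleSeq g)) t = φ g ^ t := by
  rw [powSum_eq_sum _ ht (support_heights_singleSeq hφ1 g), Finset.sum_singleton,
    heights_singleSeq_zero]

lemma metricVersion_ofReal_eq (hφ0 : ∀ u, 0 ≤ φ u) (hφ1 : φ 1 = 0) {g : G} {t : ℝ} (ht : 0 < t)
    {b : FinSeq G} (hb : tau b = g)
    (hmin : ∀ a : FinSeq G, tau a = g → powSum (heights hφ1 b) t ≤ powSum (heights hφ1 a) t) :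
    metricVersion φ (ENNReal.ofReal t) g = tNorm (ENNReal.ofReal t) (heights hφ1 b) := by
  refine IsLeast.csInf_eq ⟨⟨b, hb, rfl⟩, ?_⟩
  rintro r ⟨a, ha, rfl⟩
  change _ ≤ tNorm (ENNReal.ofReal t) (heights hφ1 a)
  rw [tNorm_ofReal (fun n => hφ0 _) ht, tNorm_ofReal (fun n => hφ0 _) ht]
  exact Real.rpow_le_rpow (powSum_nonneg (fun n => hφ0 _) t) (hmin a ha) (by positivity)

/-- If the infima can be taken over sequences whose entries have heights in a fixed finite set,
then for bounded exponents only boundedly many of these entries have non-zero height. -/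
lemma exists_powSum_le (hφ0 : ∀ u, 0 ≤ φ u) (hφ1 : φ 1 = 0) {g : G} {V : Finset ℝ}
    (hg : φ g ∈ V)
    (hred : ∀ a : FinSeq G, tau a = g → ∃ b : FinSeq G, tau b = g ∧
      ∀ n, φ (b.1 n) ≤ φ (a.1 n) ∧ (φ (b.1 n) ≤ φ g → φ (b.1 n) ∈ V)) (T : ℝ) :
    ∃ N : ℕ, ∀ t ∈ Set.Ioo 0 T, ∀ a : FinSeq G, tau a = g → ∃ b : FinSeq G, tau b = g ∧
      (∀ n ∈ (heights hφ1 b).support, heights hφ1 b n ∈ V) ∧ (heights hφ1 b).support.card ≤ N ∧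
      powSum (heights hφ1 b) t ≤ powSum (heights hφ1 a) t := by
  obtain ⟨δ, hδ, hδV⟩ : ∃ δ > 0, ∀ v ∈ V, 0 < v → δ ≤ v := by
    rcases (V.filter (0 < ·)).eq_empty_or_nonempty with h | h
    · refine ⟨1, one_pos, fun v hv hv0 => ?_⟩
      exact absurd (Finset.mem_filter.2 ⟨hv, hv0⟩) (by simp [h])
    · exact ⟨_, (Finset.mem_filter.1 (Finset.min'_mem _ h)).2,
        fun v hv hv0 => Finset.min'_le _ _ (Finset.mem_filter.2 ⟨hv, hv0⟩)⟩
  refine ⟨max 1 ⌈max 1 (φ g / δ) ^ T⌉₊, fun t ht a ha => ?_⟩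
  -- If `a` does no worse than the trivial factorization, all reduced entries are at most `φ g`,
  -- hence in `V`; otherwise the trivial factorization is used, with at most one non-zero entry.
  rcases le_or_gt (powSum (heights hφ1 a) t) (φ g ^ t) with hle | hlt
  · obtain ⟨b, hb, hba⟩ := hred a ha
    have hmono : powSum (heights hφ1 b) t ≤ powSum (heights hφ1 a) t :=
      powSum_mono (fun n => hφ0 _) (fun n => (hba n).1) ht.1
    have hmem : ∀ n, heights hφ1 b n ∈ V := fun n => (hba n).2 <|
      (Real.rpow_le_rpow_iff (hφ0 _) (hφ0 _) ht.1).1 <|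
        (rpow_le_powSum (x := heights hφ1 b) (fun n => hφ0 _) ht.1 n).trans (hmono.trans hle)
    refine ⟨b, hb, fun n _ => hmem n, le_max_of_le_right ?_, hmono⟩
    have := card_support_le (x := heights hφ1 b) hδ (hφ0 g) ht.1 ht.2.le
      (fun n hn => hδV _ (hmem n) ((hφ0 _).lt_of_ne' (Finsupp.mem_support_iff.1 hn)))
      (hmono.trans hle)
    exact_mod_cast this.trans (Nat.le_ceil _)
  · refine ⟨singleSeq g, tau_singleSeq g, fun n hn => ?_, le_max_of_le_left ?_, ?_⟩
    · rw [Finset.mem_singleton.1 (support_heights_singleSeq hφ1 g hn), heights_singleSeq_zero]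
      exact hg
    · simpa using Finset.card_le_card (support_heights_singleSeq hφ1 g)
    · rw [powSum_singleSeq hφ1 g ht.1.ne']
      exact hlt.le

lemma exists_finite_forall_eventually_metricVersion_eq (hφ0 : ∀ u, 0 ≤ φ u) (hφ1 : φ 1 = 0) {g : G}
    {V : Finset ℝ} (hg : φ g ∈ V)
    (hred : ∀ a : FinSeq G, tau a = g → ∃ b : FinSeq G, tau b = g ∧
      ∀ n, φ (b.1 n) ≤ φ (a.1 n) ∧ (φ (b.1 n) ≤ φ g → φ (b.1 n) ∈ V)) (T : ℝ) :
    ∃ Z : Set ℝ, Z.Finite ∧ ∀ s ∈ Set.Ioo 0 T, s ∉ Z → ∃ x : ℕ →₀ ℝ, ∀ᶠ t in 𝓝 s,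
      metricVersion φ (ENNReal.ofReal t) g = tNorm (ENNReal.ofReal t) x := by
  obtain ⟨N, hN⟩ := exists_powSum_le hφ0 hφ1 hg hred T
  let F : Set (ℝ → ℝ) := {f | ∃ b : FinSeq G, tau b = g ∧
    (∀ n ∈ (heights hφ1 b).support, heights hφ1 b n ∈ V) ∧ (heights hφ1 b).support.card ≤ N ∧
    powSum (heights hφ1 b) = f}
  have hF : F.Finite := (finite_powSum V N).subset fun f ⟨b, _, h1, h2, h3⟩ => ⟨_, h1, h2, h3⟩
  have han : ∀ f ∈ F, ∀ t, AnalyticAt ℝ f t := by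
    rintro f ⟨b, -, -, -, rfl⟩ t
    exact analyticAt_powSum (fun n => hφ0 _) t
  refine ⟨⋃ f ∈ F, ⋃ f' ∈ F, {t ∈ Set.Icc 0 T | f t = f' t ∧ f ≠ f'}, ?_, fun s hs hsZ => ?_⟩
  · refine hF.biUnion fun f hf => hF.biUnion fun f' hf' => ?_
    by_cases hne : f = f'
    · simp [hne]
    · exact (finite_coincidences (han f hf) (han f' hf') hne T).subset
        fun t ht => ⟨ht.1, ht.2.1⟩
  have hFne : F.Nonempty := by
    obtain ⟨b, h1, h2, h3, -⟩ := hN s hs (singleSeq g) (tau_singleSeq g)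
    exact ⟨_, b, h1, h2, h3, rfl⟩
  obtain ⟨f, hf, hfmin⟩ := Set.exists_min_image F (fun f => f s) hF hFne
  -- Outside the coincidence set the minimum at s is strict against every other function, so by
  -- continuity and finiteness of `F` it persists nearby.
  have hev : ∀ᶠ t in 𝓝 s, ∀ f' ∈ F, f t ≤ f' t := by
    refine (eventually_all_finite hF).2 fun f' hf' => ?_
    by_cases hne : f = f'
    · simp [hne]
    have hlt : f s < f' s := by
      refine (hfmin f' hf').lt_of_ne fun heq => hsZ ?_
      simp only [Set.mem_iUnion]
      exact ⟨f, hf, f', hf', Set.Ioo_subset_Icc_self hs, heq, hne⟩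
    exact ((han f hf s).continuousAt.eventually_lt (han f' hf' s).continuousAt hlt).mono
      fun t ht => ht.le
  obtain ⟨b, hb, -, -, rfl⟩ := hf
  refine ⟨heights hφ1 b, ?_⟩
  filter_upwards [hev, Ioo_mem_nhds hs.1 hs.2] with t ht htT
  refine metricVersion_ofReal_eq hφ0 hφ1 htT.1 hb fun a ha => ?_
  obtain ⟨c, h1, h2, h3, h4⟩ := hN t htT a ha
  exact (ht _ ⟨c, h1, h2, h3, rfl⟩).trans h4

end MetricVersion

/-! ### Passage to extended exponents and conclusion -/

lemma isStandard_of_eventually {α : QBarˣ} {s : ℝ} (hs : 0 < s) {x : ℕ →₀ ℝ}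
    (h : ∀ᶠ t in 𝓝 s, metricVersion M (ENNReal.ofReal t) α = tNorm (ENNReal.ofReal t) x) :
    IsStandard α (ENNReal.ofReal s) := by
  have htend : Tendsto ENNReal.toReal (𝓝 (ENNReal.ofReal s)) (𝓝 s) := by
    have := ENNReal.tendsto_toReal (ENNReal.ofReal_ne_top (r := s))
    rwa [ENNReal.toReal_ofReal hs.le] at this
  have hev : ∀ᶠ t in 𝓝 (ENNReal.ofReal s), 0 < t ∧ t < ∞ ∧ metricVersion M t α = tNorm t x := by
    filter_upwards [htend.eventually h, lt_mem_nhds (ENNReal.ofReal_pos.2 hs),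
      gt_mem_nhds (ENNReal.ofReal_lt_top (r := s))] with t h1 h2 h3
    rw [ENNReal.ofReal_toReal h3.ne] at h1
    exact ⟨h2, h3, h1⟩
  obtain ⟨U, hU, hUo, hsU⟩ := mem_nhds_iff.1 hev
  exact ⟨U, hUo, hsU, fun t ht => (hU ht).1, x, fun t ht => (hU ht).2.2⟩

end MetricMahler

theorem mainTheorem2 (α : MetricMahler.QBarˣ) (T : ℝ) (hT : 0 < T) :
    {s : ℝ≥0∞ | s ∈ Set.Ioo 0 (ENNReal.ofReal T) ∧ MetricMahler.IsExceptional α s}.Finite := by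
  open MetricMahler in
  obtain ⟨K, d, hK, hα⟩ := exists_isGaloisSubfield (isIntegral_coe α)
  have hV := finite_logM_values d (M α)
  have hmem : ∀ {β : QBarˣ} {r : ℕ}, 0 < r → ((β : QBar) : ℂ) ^ r ∈ K → M β ≤ M α →
      M β ∈ hV.toFinset := fun hr hβ hle =>
    hV.mem_toFinset.2 ⟨hle, exists_logM_eq_of_pow_mem hK hr hβ⟩
  obtain ⟨Z, hZ, h⟩ := exists_finite_forall_eventually_metricVersion_eq (φ := M) (g := α) M_nonneg
    (M_eq_zero_of_pow_eq_one one_pos (one_pow 1)) (hmem one_pos (by simpa using hα) le_rfl)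
    (fun a ha => by
      obtain ⟨b, hb, hba⟩ := exists_radical_factorization hK hα a ha
      refine ⟨b, hb, fun n => ⟨(hba n).1, fun hle => ?_⟩⟩
      obtain ⟨r, hr, hrK⟩ := (hba n).2
      exact hmem hr hrK hle) T
  refine (hZ.image ENNReal.ofReal).subset ?_
  rintro s ⟨⟨hs0, hsT⟩, -, hex⟩
  have hs : s ≠ ∞ := hsT.ne_top
  refine ⟨s.toReal, ?_, ENNReal.ofReal_toReal hs⟩
  by_contra hsZ
  have hpos : 0 < s.toReal := ENNReal.toReal_pos hs0.ne' hs
  obtain ⟨x, hx⟩ := h s.toReal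
    ⟨hpos, (ENNReal.lt_ofReal_iff_toReal_lt hs).1 hsT⟩ hsZ
  refine hex ?_
  rw [← ENNReal.ofReal_toReal hs]
  exact isStandard_of_eventually hpos hx
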